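/- Let $n>k\ge r\ge 1$ be integers. An $(n,k,r)$-locally recoverable code (LRC) is a $k$-dimensional linear subspace $C\subseteq \mathbb{F}^n$ over some finite field $\mathbb{F}$ such that for every coordinate $i$ there are a set $R\subseteq\{1,\dots,n\}\setminus\{i\}$ with $|R|\le r$ and scalars $(a_j)_{j\in R}$ in $\mathbb{F}$ with $c_i=\sum_{j\in R}a_jc_j$ for all $c\in C$. The minimum distance of $C$ is the least Hamming distance between two distinct codewords, and $\mathscr{D}(n,k,r)$ denotes the largest minimum distance among all $(n,k,r)$-LRCs, over all finite fields; "$\mathscr{D}(n,k,r)=d$" means that some $(n,k,r)$-LRC has minimum distance $d$ and none has a larger one. Put $$k_1=\left\lceil \tfrac{k}{r}\right\rceil,\quad k_2=k_1r-k,\quad n_1=\left\lceil \tfrac{n}{r+1}\right\rceil,\quad n_2=n_1(r+1)-n,\quad d^*=n-k-\left\lceil \tfrac{k}{r}\right\rceil+2 .$$ Multigraphs are finite and loopless; their order is the number of vertices and their size the number of edges, counted with multiplicity. For a family $\mathcal{F}$ of multigraphs let $eX(m,\mathcal{F})\in\mathbb{N}\cup\{\infty\}$ be the supremum of the sizes of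 the multigraphs of order $m$ that have no subgraph isomorphic to a member of $\mathcal{F}$, and let $\mathscr{F}_{k_1,k_2}$ be the family of all multigraphs of order $k_1$ and size strictly greater than $k_2$. Assume $k_1\le n_1$ (this holds whenever an $(n,k,r)$-LRC exists). Then $$\mathscr{D}(n,k,r)=d^*\quad\Longleftrightarrow\quad n_2\le eX(n_1,\mathscr{F}_{k_1,k_2}).$$ -/

import Mathlib

open scoped Graph

/-- `C` is a linear code of length `n` and dimension `k` over `F` such that every coordinate of a
codeword is a fixed linear combination of at most `r` other coordinates, i.e. an `(n,k,r)`-locally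
recoverable code (all-symbol locality `r`). -/
def IsLRC {F : Type} [Field F] (n k r : ℕ) (C : Submodule F (Fin n → F)) : Prop :=
  Module.finrank F C = k ∧
    ∀ i : Fin n, ∃ R : Finset (Fin n), i ∉ R ∧ R.card ≤ r ∧
      ∃ a : Fin n → F, ∀ c ∈ C, c i = ∑ j ∈ R, a j * c j

/-- `d` is the minimum distance of `C`: the least Hamming distance between two distinct
codewords. -/
def HasMinDist {F : Type} [Field F] [DecidableEq F] {n : ℕ}
    (C : Submodule F (Fin n → F)) (d : ℕ) : Prop :=
  IsLeast {m : ℕ | ∃ x ∈ C, ∃ y ∈ C, x ≠ y ∧ m = hammingDist x y} d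

/-- The minimum distances of all `(n,k,r)`-LRCs, over all finite fields. -/
def lrcMinDists (n k r : ℕ) : Set ℤ :=
  {z | ∃ (F : Type) (_ : Field F) (_ : Fintype F) (_ : DecidableEq F)
      (C : Submodule F (Fin n → F)) (d : ℕ), IsLRC n k r C ∧ HasMinDist C d ∧ z = d}

/-- `𝒟(n,k,r) = D`: among all `(n,k,r)`-LRCs there is one with minimum distance `D`, and none
has a larger minimum distance. -/
def IsLargestMinDist (n k r : ℕ) (D : ℤ) : Prop :=
  IsGreatest (lrcMinDists n k r) D

/-- `k₁ = ⌈k / r⌉`. -/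
def paramK1 (k r : ℕ) : ℕ := k ⌈/⌉ r

/-- `k₂ = k₁ r - k` (the subtraction never truncates for `r ≥ 1`). -/
def paramK2 (k r : ℕ) : ℕ := paramK1 k r * r - k

/-- `n₁ = ⌈n / (r + 1)⌉`. -/
def paramN1 (n r : ℕ) : ℕ := n ⌈/⌉ (r + 1)

/-- `n₂ = n₁ (r + 1) - n` (the subtraction never truncates). -/
def paramN2 (n r : ℕ) : ℕ := paramN1 n r * (r + 1) - n

/-- The Singleton-type bound `d* = n - k - ⌈k / r⌉ + 2`, as an integer. -/
def dStar (n k r : ℕ) : ℤ := (n : ℤ) - k - paramK1 k r + 2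

/-- Finite loopless multigraphs with `v` vertices and `e` edges. Vertices and edges are labelled
by natural numbers; every finite multigraph has such a labelling. -/
def IsMultigraph (G : Graph ℕ ℕ) (v e : ℕ) : Prop :=
  G.Loopless ∧ V(G).encard = v ∧ E(G).encard = e

/-- `G` has a subgraph isomorphic to `H`: an injection of the vertices and an injection of the
edges of `H` into those of `G` that preserve the ends of every edge. -/
def ContainsCopy (G H : Graph ℕ ℕ) : Prop :=
  ∃ f g : ℕ → ℕ, Set.MapsTo f V(H) V(G) ∧ Set.InjOn f V(H) ∧ Set.InjOn g E(H) ∧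
    ∀ e x y, H.IsLink e x y → G.IsLink (g e) (f x) (f y)

/-- The multigraph extremal number `eX(n, 𝓕)`: the supremum in `ℕ∞` of the sizes of the loopless
multigraphs of order `n` with no subgraph isomorphic to a member of `𝓕`. -/
noncomputable def eX (n : ℕ) (𝓕 : Set (Graph ℕ ℕ)) : ℕ∞ :=
  sSup {m : ℕ∞ | ∃ (G : Graph ℕ ℕ) (e : ℕ),
    IsMultigraph G n e ∧ (∀ H ∈ 𝓕, ¬ ContainsCopy G H) ∧ m = e}

/-- The family `ℱ_{k₁,k₂}` of all multigraphs of order `k₁` and size greater than `k₂`. -/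
def denseFamily (k₁ k₂ : ℕ) : Set (Graph ℕ ℕ) :=
  {H | ∃ e : ℕ, IsMultigraph H k₁ e ∧ k₂ < e}

/-! Both sides say that about `n₁` repair sets of size `r + 1` can be arranged in `n` coordinates so
that any `k₁` of them overlap little. For the forward implication, choose repair sets greedily, each
repairing a coordinate outside the earlier ones. The repaired coordinates in a union of `k₁` such
sets are redundant, so a union with fewer than `k + k₁` elements lowers the Singleton bound below
`d*` (`HasMinDist.add_card_le`). In an optimal code, any `k₁` sets therefore have total overlap at
most `k₁(r + 1) - (k + k₁) = k₂`. Turning every repeated incidence into an edge gives a multigraph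
on `n₁` vertices with at least `n₁(r + 1) - n = n₂` edges, any `k₁` vertices of which span at most
`k₂` edges. Conversely, such a multigraph with `n₂` edges prescribes sets of size `r + 1` whose
common elements are its edges. Use them as supports of generic local parity checks and add generic
global checks. Sparsity gives Hall's condition for every coordinate set of size below `d*`, so the
corresponding columns are independent (`exists_isLRC_of_hall`) and no nonzero codeword has weight
below `d*`. -/

/-! ### Generic parity-check matrices and Hall's condition -/

/-- A nonzero polynomial over `ZMod 2` has a non-root in some finite field. -/
lemma exists_finite_field_aeval_ne_zero {σ : Type} [Finite σ] (P : MvPolynomial σ (ZMod 2))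
    (hP : P ≠ 0) :
    ∃ (F : Type) (_ : Field F) (_ : Fintype F) (_ : Algebra (ZMod 2) F) (a : σ → F),
      MvPolynomial.aeval a P ≠ 0 := by
  classical
  -- A field with `2 ^ N` elements has more points than the degree of `P` in each variable.
  set N := P.totalDegree + 1
  have : Fintype (GaloisField 2 N) := Fintype.ofFinite _
  refine ⟨GaloisField 2 N, inferInstance, inferInstance, inferInstance, ?_⟩
  by_contra! h
  have hQ : MvPolynomial.map (algebraMap (ZMod 2) (GaloisField 2 N)) P = 0 := by
    refine MvPolynomial.eq_zero_of_eval_zero_at_prod_finset _ (fun _ => Finset.univ) ?_ ?_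
    · intro i
      have h1 : (MvPolynomial.map (algebraMap (ZMod 2) (GaloisField 2 N)) P).degreeOf i
          ≤ P.totalDegree :=
        (MvPolynomial.degreeOf_le_totalDegree _ _).trans
          (Finset.sup_mono (MvPolynomial.support_map_subset _ _))
      have h2 : (Finset.univ : Finset (GaloisField 2 N)).card = 2 ^ N := by
        rw [Finset.card_univ, ← Nat.card_eq_fintype_card, GaloisField.card 2 N (by simp [N])]
      rw [h2]
      have := Nat.lt_two_pow_self (n := N)
      omega
    · intro x _
      rw [MvPolynomial.eval_map]
      exact h x
  exact hP (MvPolynomial.map_injective _ (algebraMap (ZMod 2) (GaloisField 2 N)).injective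
    (by simpa using hQ))

/-- Over some finite field there is a matrix with prescribed support all of whose square
submatrices that admit a transversal inside the support are invertible. -/
lemma exists_matrix_det_ne_zero_of_matching {ρ ι : Type} [Finite ρ] [Fintype ι] [DecidableEq ι]
    (supp : ρ → Finset ι) :
    ∃ (F : Type) (_ : Field F) (_ : Fintype F) (H : Matrix ρ ι F),
      (∀ v x, H v x ≠ 0 ↔ x ∈ supp v) ∧
      ∀ (S : Finset ι) (f : S → ρ), Function.Injective f → (∀ x, x.1 ∈ supp (f x)) →
        (Matrix.of fun s s' : S => H (f s) s').det ≠ 0 := by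
  classical
  have := Fintype.ofFinite ρ
  let M : Matrix ρ ι (MvPolynomial (ρ × ι) (ZMod 2)) :=
    fun v x => if x ∈ supp v then MvPolynomial.X (v, x) else 0
  let T := Σ S : Finset ι, {f : S → ρ // Function.Injective f ∧ ∀ x, x.1 ∈ supp (f x)}
  -- One non-root of this product serves all requirements at once: the variables keep the support
  -- exact, the determinants keep every matched submatrix invertible.
  let P : MvPolynomial (ρ × ι) (ZMod 2) :=
    (∏ p : ρ × ι, MvPolynomial.X p) *
      ∏ t : T, (Matrix.of fun s s' : t.1 => M (t.2.1 s) s').det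
  have hdet : ∀ t : T, (Matrix.of fun s s' : t.1 => M (t.2.1 s) s').det ≠ 0 := by
    rintro ⟨S, f, hf, hfs⟩ h0
    -- Setting the matched entries to 1 and all others to 0 specializes the submatrix to the
    -- identity.
    let a : ρ × ι → ZMod 2 := fun p => if ∃ s : S, f s = p.1 ∧ s.1 = p.2 then 1 else 0
    have h1 := congrArg (MvPolynomial.aeval a) h0
    rw [map_zero, AlgHom.map_det] at h1
    have h2 : (MvPolynomial.aeval a).mapMatrix
        (Matrix.of fun s s' : S => M (f s) s') = (1 : Matrix S S (ZMod 2)) := by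
      ext s s'
      simp only [AlgHom.mapMatrix_apply, Matrix.map_apply, Matrix.of_apply, M, Matrix.one_apply]
      by_cases hss : s = s'
      · subst hss
        have : ∃ t : S, f t = f s ∧ t.1 = s.1 := ⟨s, rfl, rfl⟩
        simp only [hfs s, if_true, MvPolynomial.aeval_X, a]
        rw [if_pos this]
      · rw [if_neg hss]
        split_ifs with hs
        · rw [MvPolynomial.aeval_X]
          refine if_neg ?_
          rintro ⟨t, ht1, ht2⟩
          exact hss ((hf ht1).symm.trans (Subtype.ext ht2))
        · simp
    rw [h2, Matrix.det_one] at h1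
    exact one_ne_zero h1
  have hP : P ≠ 0 := by
    refine mul_ne_zero (Finset.prod_ne_zero_iff.2 fun p _ => MvPolynomial.X_ne_zero p)
      (Finset.prod_ne_zero_iff.2 fun t _ => hdet t)
  obtain ⟨F, iF, iFt, iA, a, ha⟩ := exists_finite_field_aeval_ne_zero P hP
  rw [map_mul, map_prod, map_prod, mul_ne_zero_iff, Finset.prod_ne_zero_iff,
    Finset.prod_ne_zero_iff] at ha
  refine ⟨F, iF, iFt, fun v x => MvPolynomial.aeval a (M v x), ?_, ?_⟩
  · intro v x
    have := ha.1 (v, x) (Finset.mem_univ _)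
    by_cases hx : x ∈ supp v <;> simp_all [M]
  · intro S f hf hfs
    have := ha.2 ⟨S, f, hf, hfs⟩ (Finset.mem_univ _)
    rw [AlgHom.map_det] at this
    exact this

/-- A subspace whose dimension is at least `k` contains one of dimension exactly `k`. -/
lemma Submodule.exists_le_finrank_eq_of_le_finrank {K V : Type*} [Field K] [AddCommGroup V]
    [Module K V] [FiniteDimensional K V] (W : Submodule K V) {k : ℕ}
    (hk : k ≤ Module.finrank K W) :
    ∃ U : Submodule K V, U ≤ W ∧ Module.finrank K U = k := by
  obtain ⟨f, hf⟩ := exists_linearIndependent_of_le_finrank hk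
  refine ⟨Submodule.span K (Set.range (W.subtype ∘ f)), ?_, ?_⟩
  · rw [Submodule.span_le]
    rintro _ ⟨i, rfl⟩
    exact (f i).2
  · have := finrank_span_eq_card (hf.map' W.subtype (Submodule.ker_subtype W))
    simpa using this

/-- A locally recoverable code with local parity checks supported on the sets `R v`, together with
`g` further generic parity checks, exists as soon as the parity checks satisfy Hall's condition for
all sets of at most `D` coordinates. -/
lemma exists_isLRC_of_hall {n k r m g D : ℕ} (hn : n = k + m + g) (R : Fin m → Finset (Fin n))
    (hR : ∀ v, (R v).card ≤ r + 1) (hcov : ∀ x, ∃ v, x ∈ R v)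
    (hall : ∀ S : Finset (Fin n), S.card ≤ D →
      S.card ≤ (Finset.univ.filter fun v => ∃ x ∈ S, x ∈ R v).card + g) :
    ∃ (F : Type) (_ : Field F) (_ : Fintype F) (_ : DecidableEq F) (C : Submodule F (Fin n → F)),
      IsLRC n k r C ∧ ∀ c ∈ C, c ≠ 0 → D < hammingNorm c := by
  classical
  let supp : Fin m ⊕ Fin g → Finset (Fin n) := Sum.elim R fun _ => Finset.univ
  obtain ⟨F, iF, iFt, H, hH, hdet⟩ := exists_matrix_det_ne_zero_of_matching supp
  have hker : k ≤ Module.finrank F (LinearMap.ker H.mulVecLin) := by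
    have h1 := H.mulVecLin.finrank_range_add_finrank_ker
    have h2 := Submodule.finrank_le (LinearMap.range H.mulVecLin)
    simp only [Module.finrank_fintype_fun_eq_card, Fintype.card_sum, Fintype.card_fin] at h1 h2
    omega
  obtain ⟨C, hC, hCk⟩ := Submodule.exists_le_finrank_eq_of_le_finrank _ hker
  have hmul : ∀ c ∈ C, ∀ v, ∑ x, H v x * c x = 0 := fun c hc v => congrFun (hC hc) v
  refine ⟨F, iF, iFt, Classical.decEq F, C, ⟨hCk, ?_⟩, ?_⟩
  · intro i
    obtain ⟨v, hv⟩ := hcov i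
    have hne : H (Sum.inl v) i ≠ 0 := (hH _ _).2 hv
    refine ⟨(R v).erase i, Finset.notMem_erase _ _, ?_,
      fun j => -(H (Sum.inl v) i)⁻¹ * H (Sum.inl v) j, ?_⟩
    · have := hR v
      rw [Finset.card_erase_of_mem hv]; omega
    · intro c hc
      have h1 := hmul c hc (Sum.inl v)
      have h2 : ∑ x, H (Sum.inl v) x * c x = ∑ x ∈ R v, H (Sum.inl v) x * c x := by
        refine (Finset.sum_subset (Finset.subset_univ _) fun x _ hx => ?_).symm
        have : H (Sum.inl v) x = 0 := by
          by_contra h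
          exact hx ((hH _ _).1 h)
        rw [this, zero_mul]
      rw [h2, ← Finset.add_sum_erase _ _ hv] at h1
      simp_rw [mul_assoc, ← Finset.mul_sum]
      rw [eq_neg_of_add_eq_zero_right h1]
      field_simp
  · intro c hc hc0
    by_contra! hle
    set S : Finset (Fin n) := Finset.univ.filter fun x => c x ≠ 0 with hS
    have hScard : S.card ≤ D := by
      refine le_of_eq_of_le ?_ hle
      simp only [hS, hammingNorm]
    have hex : ∃ f : S → Fin m ⊕ Fin g, Function.Injective f ∧
        ∀ x, f x ∈ Finset.univ.filter fun v => x.1 ∈ supp v := by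
      rw [← Finset.all_card_le_biUnion_card_iff_exists_injective]
      intro A
      -- The `g` global checks are neighbours of every coordinate, but only once `A` has an element.
      rcases A.eq_empty_or_nonempty with rfl | ⟨a, ha⟩
      · simp
      have hA := hall (A.map (Function.Embedding.subtype _))
        (((Finset.card_map _).le.trans ((Finset.card_le_univ A).trans (by simp))).trans hScard)
      rw [Finset.card_map] at hA
      refine hA.trans ?_
      have : ((Finset.univ.filter fun v => ∃ x ∈ A.map (Function.Embedding.subtype _), x ∈ R v).disjSum
          (Finset.univ : Finset (Fin g))) ⊆
          A.biUnion fun x => Finset.univ.filter fun v => x.1 ∈ supp v := by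
        intro w hw
        rw [Finset.mem_biUnion]
        rcases w with v | j
        · simp only [Finset.inl_mem_disjSum, Finset.mem_filter, Finset.mem_map] at hw
          obtain ⟨-, _, ⟨y, hy, rfl⟩, hx⟩ := hw
          exact ⟨y, hy, by simpa [supp] using hx⟩
        · exact ⟨a, ha, by simp [supp]⟩
      have := Finset.card_le_card this
      rwa [Finset.card_disjSum, Finset.card_univ, Fintype.card_fin] at this
    obtain ⟨f, hf, hfs⟩ := hex
    have hd := hdet S f hf fun x => (Finset.mem_filter.1 (hfs x)).2
    have hz : (Matrix.of fun s s' : S => H (f s) s').mulVec (fun s => c s.1) = 0 := by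
      funext s
      have h1 := hmul c hc (f s)
      rw [← Finset.sum_subset (Finset.subset_univ S) (fun x _ hx => by
        have : c x = 0 := by simpa [hS] using hx
        rw [this, mul_zero]), ← Finset.sum_coe_sort] at h1
      exact h1
    have hzero := Matrix.eq_zero_of_mulVec_eq_zero hd hz
    apply hc0
    funext x
    by_contra hx
    exact hx (congrFun hzero ⟨x, by simpa [hS] using hx⟩)

/-! ### Singleton-type bounds from redundant coordinates -/

/-- A subspace of `F^n` of dimension larger than `|B|` has a nonzero vector vanishing on `B`. -/
lemma exists_ne_zero_vanishing {F : Type} [Field F] {n : ℕ} (C : Submodule F (Fin n → F))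
    (B : Finset (Fin n)) (h : B.card < Module.finrank F C) :
    ∃ c ∈ C, c ≠ 0 ∧ ∀ x ∈ B, c x = 0 := by
  let f : C →ₗ[F] (B → F) := (LinearMap.funLeft F F (fun x : B => x.1)).comp C.subtype
  have hk : LinearMap.ker f ≠ ⊥ :=
    LinearMap.ker_ne_bot_of_finrank_lt (by simpa using h)
  obtain ⟨c, hc, hc0⟩ := Submodule.exists_mem_ne_zero_of_ne_bot hk
  refine ⟨c.1, c.2, by simpa using hc0, fun x hx => ?_⟩
  exact congrFun (LinearMap.mem_ker.1 hc) ⟨x, hx⟩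

lemma HasMinDist.le_hammingNorm {F : Type} [Field F] [DecidableEq F] {n d : ℕ}
    {C : Submodule F (Fin n → F)} (h : HasMinDist C d) {c : Fin n → F} (hc : c ∈ C) (h0 : c ≠ 0) :
    d ≤ hammingNorm c :=
  h.2 ⟨c, hc, 0, C.zero_mem, h0, by simp⟩

/-- A nonzero subspace has a minimum distance. -/
lemma exists_hasMinDist {F : Type} [Field F] [DecidableEq F] {n : ℕ}
    (C : Submodule F (Fin n → F)) (h : 0 < Module.finrank F C) :
    ∃ d, HasMinDist C d ∧ ∃ c ∈ C, c ≠ 0 ∧ d = hammingNorm c := by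
  obtain ⟨c, hc, hc0, -⟩ := exists_ne_zero_vanishing C ∅ (by simpa using h)
  let s : Set ℕ := {m : ℕ | ∃ x ∈ C, ∃ y ∈ C, x ≠ y ∧ m = hammingDist x y}
  have hs : s.Nonempty := ⟨_, c, hc, 0, C.zero_mem, hc0, rfl⟩
  refine ⟨sInf s, ⟨Nat.sInf_mem hs, fun _ hm => Nat.sInf_le hm⟩, ?_⟩
  obtain ⟨x, hx, y, hy, hxy, h⟩ := Nat.sInf_mem hs
  exact ⟨-x + y, C.add_mem (C.neg_mem hx) hy, fun h0 => hxy (neg_add_eq_zero.1 h0),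
    by rw [h, hammingDist_eq_hammingNorm]⟩

/-- If the coordinates of `T` are determined by fewer than `k` of them, namely by those outside
`I ⊆ T`, then the redundancy `|I|` improves the Singleton bound. -/
lemma HasMinDist.add_card_le {F : Type} [Field F] [DecidableEq F] {n d k : ℕ}
    {C : Submodule F (Fin n → F)} (hd : HasMinDist C d) (hk : Module.finrank F C = k)
    {T I : Finset (Fin n)} (hIT : I ⊆ T)
    (hdet : ∀ c ∈ C, (∀ x ∈ T \ I, c x = 0) → ∀ x ∈ T, c x = 0)
    (hlt : T.card < k + I.card) : d + k + I.card ≤ n + 1 := by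
  have hB : (T \ I).card = T.card - I.card := Finset.card_sdiff_of_subset hIT
  have hIc := Finset.card_le_card hIT
  have hTc : Tᶜ.card = n - T.card := by rw [Finset.card_compl, Fintype.card_fin]
  have hTn : T.card ≤ n := by simpa using Finset.card_le_univ T
  have key : ∀ A ⊆ Tᶜ, A.card + T.card < k + I.card →
      ∃ c ∈ C, c ≠ 0 ∧ ∀ x ∈ T ∪ A, c x = 0 := by
    intro A hA hAc
    obtain ⟨c, hc, hc0, hz⟩ := exists_ne_zero_vanishing C (T \ I ∪ A) (by
      have := Finset.card_union_le (T \ I) A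
      omega)
    refine ⟨c, hc, hc0, fun x hx => ?_⟩
    rcases Finset.mem_union.1 hx with hx | hx
    · exact hdet c hc (fun y hy => hz y (Finset.mem_union_left _ hy)) x hx
    · exact hz x (Finset.mem_union_right _ hx)
  -- Enlarge `T` to `k + |I| - 1` coordinates; a nonzero codeword vanishes on all of them. If there
  -- is no room, it would vanish everywhere.
  by_cases hroom : k + I.card - 1 - T.card ≤ Tᶜ.card
  · obtain ⟨A, hA, hAc⟩ := Finset.exists_subset_card_eq hroom
    obtain ⟨c, hc, hc0, hz⟩ := key A hA (by omega)
    have h1 := hd.le_hammingNorm hc hc0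
    have hdisj : Disjoint T A := by
      rw [Finset.disjoint_left]
      exact fun x hx hxA => Finset.mem_compl.1 (hA hxA) hx
    have h2 : hammingNorm c ≤ (T ∪ A)ᶜ.card := by
      refine Finset.card_le_card fun x hx => ?_
      rw [Finset.mem_compl]
      intro hx'
      exact (Finset.mem_filter.1 hx).2 (hz x hx')
    rw [Finset.card_compl, Finset.card_union_of_disjoint hdisj, Fintype.card_fin] at h2
    omega
  · obtain ⟨c, -, hc0, hz⟩ := key Tᶜ subset_rfl (by omega)
    exact absurd (funext fun x => hz x (by simp)) hc0

/-- A sequence of repair sets of exactly `r + 1` coordinates, each of which repairs a coordinate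
that is not in the earlier sets. -/
lemma IsLRC.exists_repair_sequence {F : Type} [Field F] {n k r : ℕ}
    {C : Submodule F (Fin n → F)} (hC : IsLRC n k r C) (hrn : r + 1 ≤ n) (m : ℕ)
    (hm : ∀ j < m, j * (r + 1) < n) :
    ∃ (R : ℕ → Finset (Fin n)) (i : ℕ → Fin n), (∀ j, (R j).card = r + 1) ∧
      (∀ j, i j ∈ R j) ∧ (∀ j < m, ∀ j' < j, i j ∉ R j') ∧
      ∀ j, ∀ c ∈ C, (∀ x ∈ (R j).erase (i j), c x = 0) → c (i j) = 0 := by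
  classical
  have hset : ∀ y : Fin n, ∃ Q : Finset (Fin n), Q.card = r + 1 ∧ y ∈ Q ∧
      ∀ c ∈ C, (∀ x ∈ Q.erase y, c x = 0) → c y = 0 := by
    intro y
    obtain ⟨R, hyR, hRc, a, ha⟩ := hC.2 y
    obtain ⟨Q, hRQ, -, hQ⟩ := Finset.exists_subsuperset_card_eq (n := r + 1)
      (Finset.subset_univ (insert y R))
      (by rw [Finset.card_insert_of_notMem hyR]; omega) (by simpa using hrn)
    refine ⟨Q, hQ, hRQ (Finset.mem_insert_self _ _), fun c hc hz => ?_⟩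
    rw [ha c hc]
    refine Finset.sum_eq_zero fun x hx => ?_
    rw [hz x, mul_zero]
    refine Finset.mem_erase.2 ⟨?_, hRQ (Finset.mem_insert_of_mem hx)⟩
    rintro rfl
    exact hyR hx
  choose Q hQc hQm hQd using hset
  have : Nonempty (Fin n) := ⟨⟨0, by omega⟩⟩
  suffices h : ∃ i : ℕ → Fin n, ∀ j < m, ∀ j' < j, i j ∉ Q (i j') by
    obtain ⟨i, hi⟩ := h
    exact ⟨fun j => Q (i j), i, fun j => hQc _, fun j => hQm _, hi, fun j => hQd _⟩
  clear hrn
  induction m with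
  | zero => exact ⟨fun _ => Classical.arbitrary _, by simp⟩
  | succ m ih =>
    obtain ⟨i, hi⟩ := ih fun j hj => hm j (by omega)
    have hcard : ((Finset.range m).biUnion fun j => Q (i j)).card < n := by
      refine lt_of_le_of_lt (Finset.card_biUnion_le_card_mul _ _ (r + 1) fun j _ => (hQc _).le) ?_
      rw [Finset.card_range]
      exact hm m (by omega)
    obtain ⟨y, hy⟩ : ∃ y, y ∉ (Finset.range m).biUnion fun j => Q (i j) := by
      by_contra! h
      rw [Finset.eq_univ_iff_forall.2 h] at hcard
      simp at hcard
    refine ⟨Function.update i m y, fun j hj j' hj' => ?_⟩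
    rw [Function.update_of_ne (a := j') (by omega)]
    rcases Nat.lt_succ_iff_lt_or_eq.1 hj with hj | rfl
    · rw [Function.update_of_ne (by omega)]
      exact hi j hj j' hj'
    · rw [Function.update_self]
      exact fun h => hy (Finset.mem_biUnion.2 ⟨j', Finset.mem_range.2 hj', h⟩)

/-- In the situation of `IsLRC.exists_repair_sequence`, a union of `t` repair sets that has fewer
than `k + t` elements yields an improved Singleton bound. -/
lemma HasMinDist.add_le_of_repair_sequence {F : Type} [Field F] [DecidableEq F] {n d k m : ℕ}
    {C : Submodule F (Fin n → F)} (hd : HasMinDist C d) (hk : Module.finrank F C = k)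
    {R : ℕ → Finset (Fin n)} {i : ℕ → Fin n} (hi : ∀ j, i j ∈ R j)
    (hnew : ∀ j < m, ∀ j' < j, i j ∉ R j')
    (hdet : ∀ j, ∀ c ∈ C, (∀ x ∈ (R j).erase (i j), c x = 0) → c (i j) = 0)
    (J : Finset ℕ) (hJ : ∀ j ∈ J, j < m) (hlt : (J.biUnion R).card < k + J.card) :
    d + k + J.card ≤ n + 1 := by
  classical
  have hinj : Set.InjOn i J := by
    intro a ha b hb hab
    rcases lt_trichotomy a b with h | h | h
    · exact absurd (hi a) (hab ▸ hnew b (hJ b hb) a h)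
    · exact h
    · exact absurd (hi b) (hab ▸ hnew a (hJ a ha) b h)
  have hcard : (J.image i).card = J.card := Finset.card_image_of_injOn hinj
  rw [← hcard] at hlt ⊢
  refine hd.add_card_le hk (T := J.biUnion R) ?_ ?_ hlt
  · intro x hx
    obtain ⟨j, hj, rfl⟩ := Finset.mem_image.1 hx
    exact Finset.mem_biUnion.2 ⟨j, hj, hi j⟩
  · intro c hc hz
    -- Induction along the sequence: `R j` contains no later repaired coordinate, and the earlier
    -- ones already vanish.
    have hzi : ∀ j, j ∈ J → c (i j) = 0 := by
      intro j
      induction j using Nat.strong_induction_on with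
      | _ j ih =>
        intro hj
        refine hdet j c hc fun x hx => ?_
        obtain ⟨hxi, hxR⟩ := Finset.mem_erase.1 hx
        by_cases hxI : x ∈ J.image i
        · obtain ⟨j', hj', rfl⟩ := Finset.mem_image.1 hxI
          rcases lt_trichotomy j' j with h | rfl | h
          · exact ih j' h hj'
          · exact absurd rfl hxi
          · exact absurd hxR (hnew j' (hJ j' hj') j h)
        · exact hz x (Finset.mem_sdiff.2 ⟨Finset.mem_biUnion.2 ⟨j, hj, hxR⟩, hxI⟩)
    intro x hx
    by_cases hxI : x ∈ J.image i
    · obtain ⟨j, hj, rfl⟩ := Finset.mem_image.1 hxI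
      exact hzi j hj
    · exact hz x (Finset.mem_sdiff.2 ⟨hx, hxI⟩)

/-! ### Overlap multigraphs of sequences of sets -/

/-- The incidences `(j, x)` with `x ∈ R j` and `j ∈ J`. -/
def incidences {n : ℕ} (R : ℕ → Finset (Fin n)) (J : Finset ℕ) : Finset (ℕ × Fin n) :=
  (J ×ˢ Finset.univ).filter fun p => p.2 ∈ R p.1

/-- The least index of a set that contains `x`. -/
noncomputable def firstIndex {n : ℕ} (R : ℕ → Finset (Fin n)) (x : Fin n) : ℕ :=
  sInf {j | x ∈ R j}

/-- The overlap multigraph of the first `m` members of a sequence of sets: every element of `R j`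
that already occurs in an earlier set gives an edge from `j` to the first such set. -/
noncomputable def overlapGraph {n : ℕ} (R : ℕ → Finset (Fin n)) (m : ℕ) : Graph ℕ ℕ where
  vertexSet := {j | j < m}
  -- The label encodes the whole incidence, so coordinates shared by the same two sets give distinct
  -- parallel edges.
  IsLink e a b := ∃ j x, e = Nat.pair j x.1 ∧ j < m ∧ x ∈ R j ∧ firstIndex R x < j ∧
    ((a = j ∧ b = firstIndex R x) ∨ (a = firstIndex R x ∧ b = j))
  isLink_symm := by
    rintro e -
    refine ⟨?_⟩
    rintro a b ⟨j, x, he, hj, hx, hlt, h⟩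
    exact ⟨j, x, he, hj, hx, hlt, h.symm.imp And.symm And.symm⟩
  eq_or_eq_of_isLink_of_isLink := by
    rintro e a b c d ⟨j, x, rfl, -, -, -, h⟩ ⟨j', x', he, -, -, -, h'⟩
    obtain ⟨rfl, hx⟩ := Nat.pair_eq_pair.1 he
    obtain rfl := Fin.ext hx
    rcases h with ⟨rfl, rfl⟩ | ⟨rfl, rfl⟩ <;> rcases h' with ⟨rfl, rfl⟩ | ⟨rfl, rfl⟩ <;> simp
  left_mem_of_isLink := by
    rintro e a b ⟨j, x, rfl, hj, -, hlt, h⟩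
    rcases h with ⟨rfl, rfl⟩ | ⟨rfl, rfl⟩
    · exact hj
    · exact hlt.trans hj

section overlapGraph

variable {n : ℕ} (R : ℕ → Finset (Fin n))

lemma card_incidences {s : ℕ} (hR : ∀ j, (R j).card = s) (J : Finset ℕ) :
    (incidences R J).card = J.card * s := by
  classical
  have : incidences R J = (J.sigma R).map (Equiv.sigmaEquivProd ℕ (Fin n)).toEmbedding := by
    ext ⟨j, x⟩
    simp [incidences]
  rw [this, Finset.card_map, Finset.card_sigma, Finset.sum_congr rfl fun j _ => hR j]
  simp

lemma edgeSet_overlapGraph (m : ℕ) :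
    E(overlapGraph R m) = (((incidences R (Finset.range m)).filter
      fun p => firstIndex R p.2 < p.1).image fun p => Nat.pair p.1 p.2.1 : Finset ℕ) := by
  ext e
  simp only [Finset.coe_image, Set.mem_image, Finset.mem_coe, Finset.mem_filter, incidences,
    Finset.mem_product, Finset.mem_range, Finset.mem_univ, and_true, Prod.exists]
  constructor
  · rintro ⟨a, b, j, x, he, hj, hx, hlt, -⟩
    exact ⟨j, x, ⟨⟨hj, hx⟩, hlt⟩, he.symm⟩
  · rintro ⟨j, x, ⟨⟨hj, hx⟩, hlt⟩, he⟩
    exact ⟨j, firstIndex R x, j, x, he.symm, hj, hx, hlt, Or.inl ⟨rfl, rfl⟩⟩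

lemma injective_pair_val : Function.Injective fun p : ℕ × Fin n => Nat.pair p.1 p.2.1 := by
  rintro ⟨a, x⟩ ⟨b, y⟩ h
  obtain ⟨rfl, h2⟩ := Nat.pair_eq_pair.1 h
  exact Prod.ext rfl (Fin.ext h2)

/-- The overlap graph has at least `m * s - n` edges. -/
lemma le_card_overlapGraph {s : ℕ} (hR : ∀ j, (R j).card = s) (m : ℕ) :
    ∃ e : ℕ, IsMultigraph (overlapGraph R m) m e ∧ m * s ≤ e + n := by
  classical
  set P := incidences R (Finset.range m) with hP
  refine ⟨(P.filter fun p => firstIndex R p.2 < p.1).card, ⟨?_, ?_, ?_⟩, ?_⟩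
  · refine ⟨?_⟩
    rintro e a ⟨j, x, -, -, -, hlt, h⟩
    omega
  · have : V(overlapGraph R m) = (Finset.range m : Set ℕ) := by
      ext; simp [overlapGraph]
    rw [this, Set.encard_coe_eq_coe_finsetCard, Finset.card_range]
  · rw [edgeSet_overlapGraph, Set.encard_coe_eq_coe_finsetCard,
      Finset.card_image_of_injective _ injective_pair_val]
  · have h1 := P.card_filter_add_card_filter_not (fun p => firstIndex R p.2 < p.1)
    rw [hP, card_incidences R hR, Finset.card_range, ← hP] at h1
    -- An incidence that is not an edge is the first occurrence of its coordinate, hence determined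
    -- by it.
    have h2 : (P.filter fun p => ¬ firstIndex R p.2 < p.1).card ≤ n := by
      refine le_of_le_of_eq (Finset.card_le_card_of_injOn Prod.snd
        (fun _ _ => Finset.mem_univ _) ?_) (by simp)
      have hmin : ∀ p ∈ P.filter fun p => ¬ firstIndex R p.2 < p.1, p.1 = firstIndex R p.2 := by
        intro p hp
        simp only [hP, incidences, Finset.mem_filter] at hp
        have : firstIndex R p.2 ≤ p.1 := Nat.sInf_le hp.1.2
        omega
      intro p hp q hq hpq
      refine Prod.ext ?_ hpq
      rw [hmin p hp, hmin q hq, hpq]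
    omega

/-- The number of edges of the overlap graph inside a set `J` of indices is bounded by the overlap
of the sets with index in `J`. -/
lemma card_overlap_add_card_biUnion_le {s : ℕ} (hR : ∀ j, (R j).card = s) (J : Finset ℕ) :
    ((incidences R J).filter fun p => firstIndex R p.2 ∈ J ∧ firstIndex R p.2 < p.1).card +
      (J.biUnion R).card ≤ J.card * s := by
  classical
  rw [← card_incidences R hR J]
  -- The first occurrence within `J` is never an edge inside `J`, so each element of the union
  -- accounts for one uncounted incidence.
  let μ : Fin n → ℕ := fun x => sInf {j | j ∈ J ∧ x ∈ R j}
  have hμ : ∀ x ∈ J.biUnion R, μ x ∈ J ∧ x ∈ R (μ x) := by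
    intro x hx
    obtain ⟨j, hj, hxj⟩ := Finset.mem_biUnion.1 hx
    exact Nat.sInf_mem (s := {j | j ∈ J ∧ x ∈ R j}) ⟨j, hj, hxj⟩
  have hcard : ((J.biUnion R).image fun x => (μ x, x)).card = (J.biUnion R).card :=
    Finset.card_image_of_injective _ fun x y h => (Prod.ext_iff.1 h).2
  rw [← hcard, ← Finset.card_union_of_disjoint]
  · refine Finset.card_le_card (Finset.union_subset (Finset.filter_subset _ _) ?_)
    intro p hp
    obtain ⟨x, hx, rfl⟩ := Finset.mem_image.1 hp
    simpa [incidences] using hμ x hx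
  · rw [Finset.disjoint_left]
    intro p hp hp'
    obtain ⟨x, hx, rfl⟩ := Finset.mem_image.1 hp'
    obtain ⟨hx', hJ, hlt⟩ := Finset.mem_filter.1 hp
    have hmem : x ∈ R (firstIndex R x) := Nat.sInf_mem (s := {j | x ∈ R j}) ⟨_, (hμ x hx).2⟩
    have : μ x ≤ firstIndex R x := Nat.sInf_le ⟨hJ, hmem⟩
    exact absurd hlt (by simpa using this)

/-- If any `k₁` of the sets have a large union then the overlap graph is sparse, which bounds the
multigraph extremal number from below. -/
lemma le_eX_of_card_biUnion {s k₁ k₂ m t : ℕ} (hR : ∀ j, (R j).card = s)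
    (hun : ∀ J : Finset ℕ, (∀ j ∈ J, j < m) → J.card = k₁ →
      k₁ * s ≤ k₂ + (J.biUnion R).card) (ht : t + n ≤ m * s) :
    (t : ℕ∞) ≤ eX m (denseFamily k₁ k₂) := by
  classical
  obtain ⟨e, he, hle⟩ := le_card_overlapGraph R hR m
  refine le_trans (by exact_mod_cast (by omega : t ≤ e)) (le_sSup ⟨_, e, he, ?_, rfl⟩)
  rintro H ⟨eH, ⟨-, hV, hE⟩, hlt⟩ ⟨f, g, hfm, hfi, hgi, hlink⟩
  have hVfin : V(H).Finite := Set.finite_of_encard_eq_coe hV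
  let J : Finset ℕ := hVfin.toFinset.image f
  have hJc : J.card = k₁ := by
    rw [Finset.card_image_of_injOn (by simpa using hfi)]
    rw [hVfin.encard_eq_coe_toFinset_card] at hV
    exact_mod_cast hV
  have hfJ : ∀ x ∈ V(H), f x ∈ J := fun x hx =>
    Finset.mem_image_of_mem _ (hVfin.mem_toFinset.2 hx)
  have hJm : ∀ j ∈ J, j < m := by
    intro j hj
    obtain ⟨x, hx, rfl⟩ := Finset.mem_image.1 hj
    exact hfm (hVfin.mem_toFinset.1 hx)
  have h1 := hun J hJm hJc
  have h2 := card_overlap_add_card_biUnion_le R hR J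
  set Q := (incidences R J).filter fun p => firstIndex R p.2 ∈ J ∧ firstIndex R p.2 < p.1
  have h3 : g '' E(H) ⊆ (Q.image fun p => Nat.pair p.1 p.2.1 : Finset ℕ) := by
    rintro _ ⟨ε, hε, rfl⟩
    obtain ⟨a, b, hab⟩ := H.exists_isLink_of_mem_edgeSet hε
    obtain ⟨j, x, hg, hj, hx, hltj, h⟩ := hlink ε a b hab
    have ha := hfJ a hab.left_mem
    have hb := hfJ b hab.right_mem
    rw [hg]
    refine Finset.mem_coe.2 (Finset.mem_image.2 ⟨(j, x), ?_, rfl⟩)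
    rcases h with ⟨h, h'⟩ | ⟨h, h'⟩ <;> rw [h] at ha <;> rw [h'] at hb <;>
      simp [Q, incidences, *]
  have h4 := Set.encard_le_encard h3
  rw [hgi.encard_image, hE, Set.encard_coe_eq_coe_finsetCard,
    Finset.card_image_of_injective _ injective_pair_val, Nat.cast_le] at h4
  rw [hJc] at h2
  omega

end overlapGraph

/-! ### From sparse multigraphs to families of sets -/

/-- A lower bound on the multigraph extremal number of `denseFamily k₁ k₂` yields edges such that
any `k₁` vertices span at most `k₂` of them. -/
lemma exists_edges_of_le_eX {m N k₁ k₂ : ℕ} (h : (N : ℕ∞) ≤ eX m (denseFamily k₁ k₂)) :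
    ∃ u w : Fin N → Fin m, (∀ e, u e ≠ w e) ∧ ∀ J : Finset (Fin m), J.card = k₁ →
      (Finset.univ.filter fun e => u e ∈ J ∧ w e ∈ J).card ≤ k₂ := by
  classical
  rcases Nat.eq_zero_or_pos N with rfl | hN
  · exact ⟨Fin.elim0, Fin.elim0, fun e => e.elim0, fun J _ => by simp⟩
  -- Passing to `N - 1` yields a graph with at least `N` edges without knowing that the supremum is
  -- finite or attained.
  have hlt : ((N - 1 : ℕ) : ℕ∞) < eX m (denseFamily k₁ k₂) :=
    lt_of_lt_of_le (by exact_mod_cast (by omega : N - 1 < N)) h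
  obtain ⟨_, ⟨G, e, ⟨hloop, hV, hE⟩, hfree, rfl⟩, he⟩ := lt_sSup_iff.1 hlt
  have he : N ≤ e := by
    have : N - 1 < e := by exact_mod_cast he
    omega
  have hVfin : V(G).Finite := Set.finite_of_encard_eq_coe hV
  have hEfin : E(G).Finite := Set.finite_of_encard_eq_coe hE
  have hVc : Nat.card V(G) = m := by
    rw [Nat.card_coe_set_eq, Set.ncard, hV, ENat.toNat_natCast]
  have hEc : Nat.card E(G) = e := by
    rw [Nat.card_coe_set_eq, Set.ncard, hE, ENat.toNat_natCast]
  have := hVfin.to_subtype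
  have := hEfin.to_subtype
  let φ : V(G) ≃ Fin m := Finite.equivFinOfCardEq hVc
  let ψ : Fin N → E(G) := fun i => (Finite.equivFinOfCardEq hEc).symm (Fin.castLE he i)
  have hψ : Function.Injective ψ := fun i j hij => by simpa [ψ] using hij
  have hends : ∀ i, ∃ a b, G.IsLink (ψ i).1 a b := fun i =>
    G.exists_isLink_of_mem_edgeSet (ψ i).2
  choose a b hab using hends
  refine ⟨fun i => φ ⟨a i, (hab i).left_mem⟩, fun i => φ ⟨b i, (hab i).right_mem⟩, ?_, ?_⟩
  · intro i hi
    have : a i = b i := congrArg Subtype.val (φ.injective hi)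
    have hl := hab i
    rw [← this] at hl
    exact hloop.not_isLoopAt _ _ hl
  · intro J hJ
    by_contra! hk
    set Q := Finset.univ.filter fun i : Fin N =>
      φ ⟨a i, (hab i).left_mem⟩ ∈ J ∧ φ ⟨b i, (hab i).right_mem⟩ ∈ J with hQ
    let W : Set ℕ := (J.image fun v => (φ.symm v).1 : Finset ℕ)
    have hW : ∀ x : V(G), φ x ∈ J → x.1 ∈ W := fun x hx =>
      Finset.mem_coe.2 (Finset.mem_image.2 ⟨φ x, hx, by simp⟩)
    have hsub : E(G.induce W) ⊆ E(G) := by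
      rintro ε ⟨x, y, hxy, -, -⟩
      exact hxy.edge_mem
    have hWV : W ⊆ V(G) := by
      intro x hx
      obtain ⟨v, -, rfl⟩ := Finset.mem_image.1 (Finset.mem_coe.1 hx)
      exact (φ.symm v).2
    have hQE : ((Q.image fun i => (ψ i).1 : Finset ℕ) : Set ℕ) ⊆ E(G.induce W) := by
      intro ε hε
      obtain ⟨i, hi, rfl⟩ := Finset.mem_image.1 hε
      obtain ⟨-, hi1, hi2⟩ := Finset.mem_filter.1 hi
      exact ⟨a i, b i, hab i, hW _ hi1, hW _ hi2⟩
    have hQc := Set.encard_le_encard hQE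
    rw [Set.encard_coe_eq_coe_finsetCard, Finset.card_image_of_injective Q
      (f := fun i => (ψ i).1) (Subtype.val_injective.comp hψ),
      (hEfin.subset hsub).encard_eq_coe_toFinset_card,
      Nat.cast_le] at hQc
    refine hfree (G.induce W) ⟨_, ⟨⟨?_⟩, ?_, (hEfin.subset hsub).encard_eq_coe_toFinset_card⟩,
      lt_of_lt_of_le hk hQc⟩ ⟨id, id, hWV, fun _ _ _ _ h => h, fun _ _ _ _ h => h,
        fun ε x y hxy => hxy.1⟩
    · intro ε x hx
      exact hloop.not_isLoopAt _ _ hx.1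
    · change W.encard = k₁
      rw [Set.encard_coe_eq_coe_finsetCard, Finset.card_image_of_injective J
        (f := fun v => (φ.symm v).1) (Subtype.val_injective.comp φ.symm.injective), hJ]

/-- Sets of size `r + 1`, one for each vertex of a multigraph with few edges, such that the elements
common to several sets correspond to the edges. -/
lemma exists_sets_of_edges {m n N r : ℕ} (u w : Fin N → Fin m) (huw : ∀ e, u e ≠ w e)
    (hNr : N ≤ r) (hn : n + N = m * (r + 1)) :
    ∃ R : Fin m → Finset (Fin n), (∀ x, ∃ v, x ∈ R v) ∧ ∀ M : Finset (Fin m),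
      (M.biUnion R).card + (Finset.univ.filter fun e => u e ∈ M ∧ w e ∈ M).card
        = M.card * (r + 1) := by
  classical
  let deg : Fin m → ℕ := fun v => (Finset.univ.filter fun e => v = u e ∨ v = w e).card
  have hdeg : ∀ v, deg v ≤ r + 1 := fun v => by
    have : deg v ≤ Fintype.card (Fin N) := Finset.card_le_univ _
    rw [Fintype.card_fin] at this
    omega
  -- Each vertex receives its incident edges, padded with private elements up to size `r + 1`; the
  -- padding is possible since degrees are at most `N ≤ r`.
  let R₀ : Fin m → Finset (Fin N ⊕ Σ v : Fin m, Fin (r + 1 - deg v)) := fun v =>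
    (Finset.univ.filter fun e => v = u e ∨ v = w e).disjSum
      (Finset.univ.filter fun p => v = p.1)
  have hunion : ∀ M : Finset (Fin m), M.biUnion R₀ =
      (Finset.univ.filter fun e => u e ∈ M ∨ w e ∈ M).disjSum (M.sigma fun _ => Finset.univ) := by
    intro M
    ext (e | p)
    · simp only [R₀, Finset.mem_biUnion, Finset.inl_mem_disjSum, Finset.mem_filter,
        Finset.mem_univ, true_and]
      constructor
      · rintro ⟨v, hv, rfl | rfl⟩
        exacts [Or.inl hv, Or.inr hv]
      · rintro (h | h)
        exacts [⟨_, h, Or.inl rfl⟩, ⟨_, h, Or.inr rfl⟩]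
    · simp [R₀]
  -- An edge contributes as many times as it has ends in `M`.
  have hsum : ∀ M : Finset (Fin m), ∑ v ∈ M, deg v =
      (Finset.univ.filter fun e => u e ∈ M ∨ w e ∈ M).card +
        (Finset.univ.filter fun e => u e ∈ M ∧ w e ∈ M).card := by
    intro M
    simp only [deg, Finset.card_filter]
    rw [Finset.sum_comm, ← Finset.sum_add_distrib]
    refine Finset.sum_congr rfl fun e _ => ?_
    have : ∀ v, (if v = u e ∨ v = w e then 1 else 0 : ℕ) =
        (if v = u e then 1 else 0) + if v = w e then 1 else 0 := by
      intro v
      by_cases h1 : v = u e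
      · have h2 : v ≠ w e := fun h2 => huw e (h1.symm.trans h2)
        simp only [h1, true_or, if_true, if_neg (h1 ▸ h2), add_zero]
      · simp [h1]
    rw [Finset.sum_congr rfl fun v _ => this v, Finset.sum_add_distrib, Finset.sum_ite_eq',
      Finset.sum_ite_eq']
    split_ifs <;> simp_all
  have hcard : ∀ M : Finset (Fin m),
      (M.biUnion R₀).card + (Finset.univ.filter fun e => u e ∈ M ∧ w e ∈ M).card
        = M.card * (r + 1) := by
    intro M
    have h1 : ∑ v ∈ M, (r + 1 - deg v) + ∑ v ∈ M, deg v = M.card * (r + 1) := by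
      rw [← Finset.sum_add_distrib, Finset.sum_congr rfl fun v _ => Nat.sub_add_cancel (hdeg v),
        Finset.sum_const, smul_eq_mul]
    rw [hunion, Finset.card_disjSum, Finset.card_sigma]
    simp only [Finset.card_univ, Fintype.card_fin]
    have := hsum M
    omega
  have hcov : ∀ x, ∃ v, x ∈ R₀ v := by
    rintro (e | p)
    · exact ⟨u e, by simp [R₀]⟩
    · exact ⟨p.1, by simp [R₀]⟩
  have hX : Fintype.card (Fin N ⊕ Σ v : Fin m, Fin (r + 1 - deg v)) = n := by
    have h1 := hcard Finset.univ
    have h2 : Finset.univ.biUnion R₀ = Finset.univ := by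
      ext x
      simpa using hcov x
    rw [h2, Finset.card_univ, Finset.card_univ, Fintype.card_fin] at h1
    simp only [Finset.mem_univ, and_self, Finset.filter_true, Finset.card_univ,
      Fintype.card_fin] at h1
    omega
  let φ := Fintype.equivFinOfCardEq hX
  refine ⟨fun v => (R₀ v).map φ.toEmbedding, fun x => ?_, fun M => ?_⟩
  · obtain ⟨v, hv⟩ := hcov (φ.symm x)
    exact ⟨v, by simpa using hv⟩
  · have : (M.biUnion fun v => (R₀ v).map φ.toEmbedding) = (M.biUnion R₀).map φ.toEmbedding := by
      simp only [Finset.map_eq_image]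
      exact Finset.biUnion_image.symm
    rw [this, Finset.card_map, hcard]

/-! ### Optimal codes and the equivalence -/

/-- The Singleton-type bound for locally recoverable codes. -/
lemma IsLRC.minDist_le {F : Type} [Field F] [DecidableEq F] {n k r t d : ℕ}
    {C : Submodule F (Fin n → F)} (hC : IsLRC n k r C) (hd : HasMinDist C d) (hrn : r + 1 ≤ n)
    (htk : t * r < k) (htn : ∀ j < t, j * (r + 1) < n) : d + k + t ≤ n + 1 := by
  classical
  obtain ⟨R, i, hRc, hi, hnew, hdet⟩ := hC.exists_repair_sequence hrn t htn
  have := hd.add_le_of_repair_sequence hC.1 hi hnew hdet (Finset.range t)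
    (fun j hj => Finset.mem_range.1 hj) (by
      refine lt_of_le_of_lt (Finset.card_biUnion_le_card_mul _ _ (r + 1) fun j _ => (hRc j).le) ?_
      rw [Finset.card_range, mul_add, mul_one]
      omega)
  rwa [Finset.card_range] at this

/-- A sparse multigraph yields a locally recoverable code with large minimum distance. -/
lemma exists_isLRC_of_edges {n k r m N k₁ k₂ : ℕ} (u w : Fin N → Fin m) (huw : ∀ e, u e ≠ w e)
    (hsparse : ∀ J : Finset (Fin m), J.card = k₁ →
      (Finset.univ.filter fun e => u e ∈ J ∧ w e ∈ J).card ≤ k₂)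
    (hNr : N ≤ r) (hn : n + N = m * (r + 1)) (hk : k + k₂ = k₁ * r) (hk₁m : k₁ ≤ m) :
    ∃ (F : Type) (_ : Field F) (_ : Fintype F) (_ : DecidableEq F) (C : Submodule F (Fin n → F)),
      IsLRC n k r C ∧ ∀ c ∈ C, c ≠ 0 → n + 1 < hammingNorm c + k + k₁ := by
  classical
  obtain ⟨R, hcov, hR⟩ := exists_sets_of_edges u w huw hNr hn
  have hun : ∀ M : Finset (Fin m), k₁ ≤ M.card → k + M.card ≤ (M.biUnion R).card := by
    intro M hM
    have h1 := hR M
    rw [mul_add, mul_one] at h1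
    rcases hM.eq_or_lt with h | h
    · have h2 := hsparse M h.symm
      rw [← h] at h1 ⊢
      omega
    · have h2 : (Finset.univ.filter fun e => u e ∈ M ∧ w e ∈ M).card ≤ N := by
        simpa using Finset.card_le_univ (Finset.univ.filter fun e => u e ∈ M ∧ w e ∈ M)
      have h3 := Nat.mul_le_mul_right r h
      rw [Nat.succ_mul] at h3
      omega
  have hkm : k + m ≤ n := by
    have h1 := hun Finset.univ (by simpa using hk₁m)
    have h2 := Finset.card_le_univ (Finset.univ.biUnion R)
    simp only [Finset.card_univ, Fintype.card_fin] at h1 h2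
    omega
  have hRc : ∀ v, (R v).card ≤ r + 1 := by
    intro v
    have := hR {v}
    rw [Finset.singleton_biUnion, Finset.card_singleton, one_mul] at this
    omega
  have hall : ∀ S : Finset (Fin n), S.card ≤ n + 1 - k - k₁ →
      S.card ≤ (Finset.univ.filter fun v => ∃ x ∈ S, x ∈ R v).card + (n - k - m) := by
    intro S hS
    set T := Finset.univ.filter fun v => ∃ x ∈ S, x ∈ R v with hT
    have hTc : Tᶜ.card = m - T.card := by rw [Finset.card_compl, Fintype.card_fin]
    have hTm : T.card ≤ m := by simpa using Finset.card_le_univ T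
    -- `S` avoids the sets it does not meet. If there are at least `k₁` of these, their large union
    -- bounds `S`; otherwise `T` has more than `m - k₁` members and the size bound on `S` suffices.
    rcases le_or_gt k₁ Tᶜ.card with h | h
    · have h1 := hun Tᶜ h
      have hdisj : Disjoint S (Tᶜ.biUnion R) := by
        rw [Finset.disjoint_left]
        intro x hx hx'
        obtain ⟨v, hv, hxv⟩ := Finset.mem_biUnion.1 hx'
        exact Finset.mem_compl.1 hv (Finset.mem_filter.2 ⟨Finset.mem_univ _, x, hx, hxv⟩)
      have h2 := Finset.card_le_univ (S ∪ Tᶜ.biUnion R)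
      rw [Finset.card_union_of_disjoint hdisj, Fintype.card_fin] at h2
      omega
    · omega
  obtain ⟨F, i₁, i₂, i₃, C, hC, hCD⟩ := exists_isLRC_of_hall
    (show n = k + m + (n - k - m) by omega) R hRc hcov hall
  refine ⟨F, i₁, i₂, i₃, C, hC, fun c hc hc0 => ?_⟩
  have := hCD c hc hc0
  omega

lemma ceilDiv_mul_bounds (a : ℕ) {b : ℕ} (ha : 0 < a) (hb : 0 < b) :
    a ≤ a ⌈/⌉ b * b ∧ 0 < a ⌈/⌉ b ∧ (a ⌈/⌉ b - 1) * b < a := by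
  have h1 : a ≤ b * (a ⌈/⌉ b) := (ceilDiv_le_iff_le_mul hb).1 le_rfl
  have h2 : 0 < a ⌈/⌉ b := by
    rcases Nat.eq_zero_or_pos (a ⌈/⌉ b) with h | h
    · rw [h] at h1; omega
    · exact h
  refine ⟨by rwa [mul_comm], h2, ?_⟩
  by_contra! h
  have := (ceilDiv_le_iff_le_mul hb).2 (h.trans_eq (mul_comm _ _))
  omega

theorem mainTheorem9 (n k r : ℕ) (hr : 1 ≤ r) (hrk : r ≤ k) (hkn : k < n)
    (hk₁n₁ : paramK1 k r ≤ paramN1 n r) :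
    IsLargestMinDist n k r (dStar n k r) ↔
      (paramN2 n r : ℕ∞) ≤ eX (paramN1 n r) (denseFamily (paramK1 k r) (paramK2 k r)) := by
  obtain ⟨hk1, hk1pos, hk1'⟩ := ceilDiv_mul_bounds k (b := r) (by omega) hr
  obtain ⟨hn1, hn1pos, hn1'⟩ := ceilDiv_mul_bounds n (b := r + 1) (by omega) (by omega)
  have hk2 : k + paramK2 k r = paramK1 k r * r := Nat.add_sub_cancel' hk1
  have hn2 : n + paramN2 n r = paramN1 n r * (r + 1) := Nat.add_sub_cancel' hn1
  change 0 < paramK1 k r at hk1pos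
  change (paramK1 k r - 1) * r < k at hk1'
  change 0 < paramN1 n r at hn1pos
  change (paramN1 n r - 1) * (r + 1) < n at hn1'
  generalize paramK2 k r = k₂ at *
  generalize paramN2 n r = n₂ at *
  rw [dStar]
  generalize paramK1 k r = k₁ at *
  generalize paramN1 n r = n₁ at *
  have hn2r : n₂ ≤ r := by
    obtain ⟨a, rfl⟩ := Nat.exists_eq_add_of_le' hn1pos
    rw [Nat.add_sub_cancel] at hn1'
    rw [add_mul] at hn2
    omega
  have hnew : ∀ j < n₁, j * (r + 1) < n := fun j hj =>
    lt_of_le_of_lt (Nat.mul_le_mul_right _ (by omega)) hn1'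
  have hupper : ∀ (F : Type) [Field F] [DecidableEq F] (C : Submodule F (Fin n → F)) (d : ℕ),
      IsLRC n k r C → HasMinDist C d → d + k + k₁ ≤ n + 2 := by
    intro F _ _ C d hC hd
    -- Applied with `t = k₁ - 1`, the largest `t` with `t * r < k`.
    have := hC.minDist_le hd (by omega) hk1' fun j hj => hnew j (by omega)
    omega
  constructor
  · rintro ⟨⟨F, _, _, _, C, d, hC, hd, hz⟩, -⟩
    obtain ⟨R, i, hRc, hi, hfresh, hdet⟩ := hC.exists_repair_sequence (by omega) n₁ hnew
    refine le_eX_of_card_biUnion R hRc (fun J hJ hJc => ?_) (by omega)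
    by_contra! hlt
    have := hd.add_le_of_repair_sequence hC.1 hi hfresh hdet J hJ (by
      rw [hJc]
      rw [mul_add, mul_one] at hlt
      omega)
    omega
  · intro h
    obtain ⟨u, w, huw, hsparse⟩ := exists_edges_of_le_eX h
    obtain ⟨F, i₁, i₂, i₃, C, hC, hCD⟩ := exists_isLRC_of_edges
      u w huw hsparse hn2r hn2 hk2 hk₁n₁
    obtain ⟨d, hd, c, hc, hc0, hdc⟩ := exists_hasMinDist C (by rw [hC.1]; omega)
    have h1 := hCD c hc hc0
    have h2 := hupper F C d hC hd
    refine ⟨⟨F, i₁, i₂, i₃, C, d, hC, hd, by omega⟩, ?_⟩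
    rintro _ ⟨F', _, _, _, C', d', hC', hd', rfl⟩
    have := hupper F' C' d' hC' hd'
    omega
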